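/- Write $\mathbb{D}_r=\{z\in\mathbb{C}:|z|<r\}$, $\mathbb{D}=\mathbb{D}_1$, $D(f)=zf_z-\overline{z}f_{\overline z}$ and $J_f=|f_z|^2-|f_{\overline z}|^2$. Put $$s_0=\frac{\sqrt{17}-1}{\sqrt{17}-3}\sqrt{\frac{2}{5-\sqrt{17}}},\qquad M_0=\frac{\pi}{2\sqrt[4]{2\pi^2-16}},\qquad M_1=\frac{\pi}{\sqrt{\pi^2-8}},$$ and for $M\ge 1$ $$\lambda_0(M)=\begin{cases}\dfrac{\sqrt2}{\sqrt{M^2-1}+\sqrt{M^2+1}}, & 1\le M\le M_0,\\[2mm] \dfrac{\pi}{4M}, & M>M_0,\end{cases}\qquad T(M)=\begin{cases}\sqrt{2M^2-2}, & 1\le M\le M_1,\\[1mm] \dfrac{4M}{\pi}, & M>M_1.\end{cases}$$ **Theorem.** Let $M\ge 1$. The equation $$\lambda_0(M)-\frac{48M}{\pi^2}s_0\arctan\rho-\frac{2T(M)\rho}{(1-\rho)^3}=0$$ has exactly one solution $\rho$ in $(0,1)$, and this $\rho$ has the following property. Let $p\ge 1$ be an integer, let $G$ be a complex-valued harmonic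 function on $\mathbb{D}$ with $G(0)=0$, $J_G(0)=1$ and $|G(z)|\le M$ for all $z\in\mathbb{D}$, and let $f(z)=|z|^{2(p-1)}G(z)$ for $z\in\mathbb{D}$. Then $D(f)$ is univalent (injective) in $\mathbb{D}_\rho$, and the range $D(f)(\mathbb{D}_\rho)$ contains the disk $\mathbb{D}_R$, where $$R=\rho^{2p-1}\Big[\lambda_0(M)-\frac{16M}{\pi^2}s_0\arctan\rho\Big]>0 .$$ Moreover, if $M=1$, then there is a constant $\alpha$ with $|\alpha|=1$ such that $G(z)=\alpha z$, i.e. $f(z)=\alpha|z|^{2(p-1)}z$, for all $z\in\mathbb{D}$, and $f$ is univalent in $\mathbb{D}$. -/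

import Mathlib

open Metric Set

noncomputable section

/-- The Wirtinger derivative `f_z = (f_x - i f_y) / 2`. -/
def wirtingerDz (f : ℂ → ℂ) (z : ℂ) : ℂ :=
  (fderiv ℝ f z 1 - Complex.I * fderiv ℝ f z Complex.I) / 2

/-- The Wirtinger derivative `f_{z̄} = (f_x + i f_y) / 2`. -/
def wirtingerDzbar (f : ℂ → ℂ) (z : ℂ) : ℂ :=
  (fderiv ℝ f z 1 + Complex.I * fderiv ℝ f z Complex.I) / 2

/-- The Jacobian `J_f = |f_z|² - |f_{z̄}|²`. -/
def jacobianC (f : ℂ → ℂ) (z : ℂ) : ℝ :=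
  ‖wirtingerDz f z‖ ^ 2 - ‖wirtingerDzbar f z‖ ^ 2

/-- The differential operator `D f = z f_z - z̄ f_{z̄}`. -/
def opD (f : ℂ → ℂ) (z : ℂ) : ℂ :=
  z * wirtingerDz f z - (starRingEnd ℂ) z * wirtingerDzbar f z

/-- The constant `s₀ ≈ 4.1996`. -/
def landauS0 : ℝ :=
  (Real.sqrt 17 - 1) / (Real.sqrt 17 - 3) * Real.sqrt (2 / (5 - Real.sqrt 17))

/-- The threshold `M₀ = π / (2 (2π² - 16)^{1/4}) ≈ 1.1296`. -/
def landauM0 : ℝ :=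
  Real.pi / (2 * (2 * Real.pi ^ 2 - 16) ^ ((1 : ℝ) / 4))

/-- The threshold `M₁ = π / √(π² - 8) ≈ 2.2976`. -/
def landauM1 : ℝ :=
  Real.pi / Real.sqrt (Real.pi ^ 2 - 8)

/-- The constant `λ₀(M)`, for `M ≥ 1`. -/
def landauLambda0 (M : ℝ) : ℝ :=
  if M ≤ landauM0 then
    Real.sqrt 2 / (Real.sqrt (M ^ 2 - 1) + Real.sqrt (M ^ 2 + 1))
  else Real.pi / (4 * M)

/-- The constant `T(M)`, for `M ≥ 1`. -/
def landauT (M : ℝ) : ℝ :=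
  if M ≤ landauM1 then Real.sqrt (2 * M ^ 2 - 2) else 4 * M / Real.pi

/-- The left-hand side of the equation that determines the radius of univalence. -/
def landauEq (M ρ : ℝ) : ℝ :=
  landauLambda0 M - 48 * M / Real.pi ^ 2 * landauS0 * Real.arctan ρ
    - 2 * landauT M * ρ / (1 - ρ) ^ 3

/-- The radius of the covered disk,
`R = ρ^{2p-1} [λ₀(M) - (16 M / π²) s₀ arctan ρ]`. -/
def landauR (M : ℝ) (p : ℕ) (ρ : ℝ) : ℝ :=
  ρ ^ (2 * p - 1) *
    (landauLambda0 M - 16 * M / Real.pi ^ 2 * landauS0 * Real.arctan ρ)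

end

/-!
Write `G = h + conj g` with `h`, `g` holomorphic on the unit disk, and put `a = h'(0)`, `b = g'(0)`.
The operator `D` is `-i` times the derivative along rotations, so it does not see the radial factor,
and `D f = |z| ^ (2 (p - 1)) Φ` with `Φ = z h' - conj (z g')` (`opD_norm_pow_mul`).

*Size of the coefficients.* Parseval's identity on circles bounds `|a|² + |b|² + |aₙ|²` by `M²`
(`sq_taylorCoeff_le`), and integration against `2 cos (θ + c)` gives `|a| + |b| ≤ 4 M / π`
(`taylorCoeff_one_add_le`). As `|a|² - |b|² = 1`, these two estimates give `|a| - |b| ≥ λ₀(M)`, one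
on each side of the threshold `M₀` (`landauLambda0_le_sub`).

*Univalence.* The left-hand side of the equation is strictly decreasing on `[0, 1)`, and it changes
sign on `[0, 1 / 10]`. At the root, `λ₀(M) ≥ 3 K` with `K = (16 M / π²) s₀ arctan ρ ≥ 6.4 M ρ`. On
this small disk the bounds `|aₙ|, |bₙ| ≤ M` already show that `Φ` differs from the real-linear map
`L v = a v - conj (b v)` by a map with Lipschitz constant `ε = 11 M ρ`
(`norm_mul_deriv_sub_le`), and `√2 ε < λ₀(M) ≤ |a| - |b|`. Such a perturbation of an expanding linear
map remains injective after multiplication by any power of the norm (`injOn_norm_pow_smul`): if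
`|x| ≤ |y|` have the same image, then `Φ y = t Φ x` with `0 ≤ t ≤ 1`, so `L` is small on the sum of
`t (y - x)` and `(1 - t) y`. These vectors make an angle of at most `π / 2`, so their sum is at least
`1 / √2` times the sum of their lengths, and both vanish.

*Covering.* The same argument shows that the derivative of `D f` is invertible away from `0`
(`injective_fderiv_norm_pow_smul`). On the circle of radius `ρ` one has
`|D f| ≥ ρ ^ (2 p - 1) (λ₀(M) - K) = R`. The image of the punctured disk is therefore open and
relatively closed in the connected punctured disk of radius `R`
(`ball_subset_image_norm_pow_smul`).

*The case `M = 1`.* Here `|a|² ≥ 1` exhausts Parseval's bound, and all other coefficients vanish.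
-/

/-! ### Fourier coefficients on circles -/

/-- The `n`-th Fourier coefficient of `θ ↦ F (r e^{iθ})`. -/
noncomputable def circleCoeff (F : ℂ → ℂ) (r : ℝ) (n : ℤ) : ℂ :=
  fourierCoeffOn Real.two_pi_pos (fun θ => F (circleMap 0 r θ)) n

lemma circleCoeff_eq (F : ℂ → ℂ) (r : ℝ) (n : ℤ) :
    circleCoeff F r n = (2 * Real.pi : ℂ)⁻¹ *
      ∫ θ in (0 : ℝ)..2 * Real.pi, Complex.exp (-(n * θ * Complex.I)) * F (circleMap 0 r θ) := by
  have hpi : (Real.pi : ℂ) ≠ 0 := by exact_mod_cast Real.pi_ne_zero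
  rw [circleCoeff, fourierCoeffOn_eq_integral, Complex.real_smul]
  congr 1
  · simp
  · refine intervalIntegral.integral_congr fun θ _ => ?_
    simp only [fourier_coe_apply, smul_eq_mul]
    congr 2
    push_cast
    field_simp
    ring

lemma circleCoeff_conj (F : ℂ → ℂ) (r : ℝ) (n : ℤ) :
    circleCoeff (fun z => starRingEnd ℂ (F z)) r n = starRingEnd ℂ (circleCoeff F r (-n)) := by
  rw [circleCoeff_eq, circleCoeff_eq, map_mul,
    intervalIntegral.integral_of_le Real.two_pi_pos.le,
    intervalIntegral.integral_of_le Real.two_pi_pos.le, ← integral_conj]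
  congr 1
  · simp [Complex.conj_ofNat]
  · refine MeasureTheory.integral_congr_ae (Filter.Eventually.of_forall fun θ => ?_)
    simp [← Complex.exp_conj]

lemma circleMap_mem_ball {r : ℝ} (hr0 : 0 < r) (hr1 : r < 1) (θ : ℝ) :
    circleMap 0 r θ ∈ ball (0 : ℂ) 1 := by
  simpa [abs_of_pos hr0] using hr1

lemma continuous_comp_circleMap {F : ℂ → ℂ} (hF : ContinuousOn F (ball 0 1)) {r : ℝ}
    (hr0 : 0 < r) (hr1 : r < 1) : Continuous fun θ => F (circleMap 0 r θ) :=
  hF.comp_continuous (continuous_circleMap 0 r) (circleMap_mem_ball hr0 hr1)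

lemma circleCoeff_add {F H : ℂ → ℂ} (hF : ContinuousOn F (ball 0 1))
    (hH : ContinuousOn H (ball 0 1)) {r : ℝ} (hr0 : 0 < r) (hr1 : r < 1) (n : ℤ) :
    circleCoeff (fun z => F z + H z) r n = circleCoeff F r n + circleCoeff H r n := by
  have h1 := continuous_comp_circleMap hF hr0 hr1
  have h2 := continuous_comp_circleMap hH hr0 hr1
  simp only [circleCoeff_eq, ← mul_add]
  rw [← intervalIntegral.integral_add]
  · simp only [mul_add]
  · exact (Continuous.mul (by fun_prop) h1).intervalIntegrable _ _
  · exact (Continuous.mul (by fun_prop) h2).intervalIntegrable _ _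

/-- Cauchy's formula for the Taylor coefficients, read on the circle of radius `r`. -/
lemma circleCoeff_natCast {h : ℂ → ℂ} (hh : DifferentiableOn ℂ h (ball 0 1)) {r : ℝ}
    (hr0 : 0 < r) (hr1 : r < 1) (n : ℕ) :
    circleCoeff h r n = r ^ n * (iteratedDeriv n h 0 / n.factorial) := by
  have hsub : closedBall (0 : ℂ) r ⊆ ball 0 1 := closedBall_subset_ball hr1
  have h1 := ((hh.mono hsub).hasFPowerSeriesOnBall (R := ⟨r, hr0.le⟩) hr0).hasFPowerSeriesAt
  have h2 := (hh.analyticAt (ball_mem_nhds 0 one_pos)).hasFPowerSeriesAt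
  have h3 := h1.eq_formalMultilinearSeries h2
  have h4 := congrArg (fun p : FormalMultilinearSeries ℂ ℂ ℂ => p.coeff n) h3
  simp only [FormalMultilinearSeries.coeff_ofScalars] at h4
  rw [← h4, FormalMultilinearSeries.coeff]
  change _ = _ * (cauchyPowerSeries h 0 r n) fun _ => 1
  have hrC : (r : ℂ) ≠ 0 := by exact_mod_cast hr0.ne'
  have hpi : (Real.pi : ℂ) ≠ 0 := by exact_mod_cast Real.pi_ne_zero
  have hI : (∮ z in C(0, r), (1 / (z - 0)) ^ n • (z - 0)⁻¹ • h z) =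
      (Complex.I * ((r : ℂ) ^ n)⁻¹) * ∫ θ in (0 : ℝ)..2 * Real.pi,
        Complex.exp (-(((n : ℤ) : ℂ) * θ * Complex.I)) * h (circleMap 0 r θ) := by
    rw [circleIntegral, ← intervalIntegral.integral_const_mul]
    refine intervalIntegral.integral_congr fun θ _ => ?_
    have he := Complex.exp_ne_zero (θ * Complex.I)
    simp only [deriv_circleMap, smul_eq_mul, circleMap, zero_add, sub_zero]
    rw [Complex.exp_neg, Int.cast_natCast, mul_assoc (n : ℂ), Complex.exp_nat_mul,
      div_pow, one_pow, mul_pow]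
    field_simp
  have hJ : ∀ J : ℂ, (2 * Real.pi : ℂ)⁻¹ * J =
      r ^ n * ((2 * Real.pi * Complex.I)⁻¹ * (Complex.I * ((r : ℂ) ^ n)⁻¹ * J)) := by
    intro J
    field_simp
  rw [cauchyPowerSeries_apply, circleCoeff_eq, hI, smul_eq_mul]
  exact hJ _

/-- A holomorphic function has no Fourier coefficients of negative index. -/
lemma circleCoeff_neg {h : ℂ → ℂ} (hh : DifferentiableOn ℂ h (ball 0 1)) {r : ℝ}
    (hr0 : 0 < r) (hr1 : r < 1) {n : ℕ} (hn : 1 ≤ n) :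
    circleCoeff h r (-(n : ℤ)) = 0 := by
  obtain ⟨m, rfl⟩ := Nat.exists_eq_add_of_le' hn
  have hsub : closedBall (0 : ℂ) r ⊆ ball 0 1 := closedBall_subset_ball hr1
  have h0 : (∮ z in C(0, r), z ^ m * h z) = 0 := by
    refine Complex.circleIntegral_eq_zero_of_differentiable_on_off_countable hr0.le
      countable_empty ?_ ?_
    · exact (continuous_pow m).continuousOn.mul (hh.continuousOn.mono hsub)
    · intro z hz
      exact (differentiableAt_pow m).mul
        (hh.differentiableAt (isOpen_ball.mem_nhds (hsub (ball_subset_closedBall hz.1))))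
  have hrC : (r : ℂ) ≠ 0 := by exact_mod_cast hr0.ne'
  have h5 : (∮ z in C(0, r), z ^ m * h z) = (r ^ (m + 1) * Complex.I) *
      ∫ θ in (0 : ℝ)..2 * Real.pi,
        Complex.exp (-(((-((m + 1 : ℕ) : ℤ) : ℤ) : ℂ) * θ * Complex.I)) *
          h (circleMap 0 r θ) := by
    rw [circleIntegral, ← intervalIntegral.integral_const_mul]
    refine intervalIntegral.integral_congr fun θ _ => ?_
    simp only [deriv_circleMap, smul_eq_mul, circleMap, zero_add]
    have : Complex.exp (-(((-((m + 1 : ℕ) : ℤ) : ℤ) : ℂ) * θ * Complex.I)) =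
        Complex.exp (θ * Complex.I) ^ (m + 1) := by
      rw [← Complex.exp_nat_mul]
      congr 1
      push_cast
      ring
    rw [this]
    ring
  rw [h0] at h5
  rw [circleCoeff_eq]
  rcases mul_eq_zero.mp h5.symm with h6 | h6
  · exact absurd h6 (mul_ne_zero (pow_ne_zero _ hrC) Complex.I_ne_zero)
  · rw [h6, mul_zero]

lemma continuousOn_conj {g : ℂ → ℂ} {s : Set ℂ} (hg : ContinuousOn g s) :
    ContinuousOn (fun z => starRingEnd ℂ (g z)) s :=
  Complex.continuous_conj.comp_continuousOn hg

/-- The `n`-th Taylor coefficient at `0`, as a quotient of derivatives. -/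
noncomputable def taylorCoeff (h : ℂ → ℂ) (n : ℕ) : ℂ := iteratedDeriv n h 0 / n.factorial

/-- For `n ≥ 1` the Fourier coefficients of `h + conj g` of index `n` see only `h`. -/
lemma circleCoeff_harmonic {h g : ℂ → ℂ} (hh : DifferentiableOn ℂ h (ball 0 1))
    (hg : DifferentiableOn ℂ g (ball 0 1)) {r : ℝ} (hr0 : 0 < r) (hr1 : r < 1)
    {n : ℕ} (hn : 1 ≤ n) :
    circleCoeff (fun z => h z + starRingEnd ℂ (g z)) r n = r ^ n * taylorCoeff h n := by
  rw [circleCoeff_add hh.continuousOn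
      (continuousOn_conj hg.continuousOn) hr0 hr1,
    circleCoeff_conj, circleCoeff_neg hg hr0 hr1 hn, circleCoeff_natCast hh hr0 hr1]
  simp [taylorCoeff]

lemma circleCoeff_harmonic_neg {h g : ℂ → ℂ} (hh : DifferentiableOn ℂ h (ball 0 1))
    (hg : DifferentiableOn ℂ g (ball 0 1)) {r : ℝ} (hr0 : 0 < r) (hr1 : r < 1)
    {n : ℕ} (hn : 1 ≤ n) :
    circleCoeff (fun z => h z + starRingEnd ℂ (g z)) r (-(n : ℤ)) =
      r ^ n * starRingEnd ℂ (taylorCoeff g n) := by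
  rw [circleCoeff_add hh.continuousOn
      (continuousOn_conj hg.continuousOn) hr0 hr1,
    circleCoeff_conj, circleCoeff_neg hh hr0 hr1 hn, neg_neg, circleCoeff_natCast hg hr0 hr1]
  simp [taylorCoeff]

/-- Bessel's inequality on the circle of radius `r`. -/
lemma sum_sq_circleCoeff_le {F : ℂ → ℂ} (hF : ContinuousOn F (ball 0 1)) {M : ℝ}
    (hM : ∀ z ∈ ball (0 : ℂ) 1, ‖F z‖ ≤ M) {r : ℝ} (hr0 : 0 < r) (hr1 : r < 1)
    (s : Finset ℤ) : ∑ n ∈ s, ‖circleCoeff F r n‖ ^ 2 ≤ M ^ 2 := by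
  have hc := continuous_comp_circleMap hF hr0 hr1
  have hb : ∀ θ, ‖F (circleMap 0 r θ)‖ ≤ M := fun θ => hM _ (circleMap_mem_ball hr0 hr1 θ)
  have hL2 : MeasureTheory.MemLp (fun θ => F (circleMap 0 r θ)) 2
      (MeasureTheory.volume.restrict (Ioc 0 (2 * Real.pi))) :=
    MeasureTheory.MemLp.of_bound hc.aestronglyMeasurable M (Filter.Eventually.of_forall hb)
  have hs := hasSum_sq_fourierCoeffOn Real.two_pi_pos hL2
  refine (sum_le_hasSum s (fun _ _ => sq_nonneg _) hs).trans ?_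
  have hI : ∫ θ in (0 : ℝ)..2 * Real.pi, ‖F (circleMap 0 r θ)‖ ^ 2 ≤
      ∫ _ in (0 : ℝ)..2 * Real.pi, M ^ 2 := by
    refine intervalIntegral.integral_mono_on Real.two_pi_pos.le
      ((hc.norm.pow 2).intervalIntegrable _ _) (by simp) fun θ _ => ?_
    exact pow_le_pow_left₀ (norm_nonneg _) (hb θ) 2
  rw [intervalIntegral.integral_const, sub_zero, smul_eq_mul] at hI
  rw [sub_zero, smul_eq_mul, inv_mul_le_iff₀ Real.two_pi_pos]
  exact hI

/-- If a bound holds on every circle of radius `r < 1`, it persists in the limit `r → 1`. -/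
lemma le_of_forall_lt_one {φ : ℝ → ℝ} (hφ : Continuous φ) {C : ℝ}
    (h : ∀ r, 0 < r → r < 1 → φ r ≤ C) : φ 1 ≤ C := by
  have ht : Filter.Tendsto φ (nhdsWithin 1 (Iio 1)) (nhds (φ 1)) :=
    hφ.continuousAt.tendsto.mono_left nhdsWithin_le_nhds
  refine le_of_tendsto ht ?_
  filter_upwards [Ioo_mem_nhdsLT (show (0 : ℝ) < 1 from one_pos)] with r hr
  exact h r hr.1 hr.2

/-- The part of Parseval's inequality for a bounded harmonic function `h + conj g` that involves
the linear coefficients and one further coefficient of `h`. -/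
lemma sq_taylorCoeff_le {h g : ℂ → ℂ} (hh : DifferentiableOn ℂ h (ball 0 1))
    (hg : DifferentiableOn ℂ g (ball 0 1)) {M : ℝ}
    (hM : ∀ z ∈ ball (0 : ℂ) 1, ‖h z + starRingEnd ℂ (g z)‖ ≤ M) {n : ℕ} (hn : 2 ≤ n) :
    ‖taylorCoeff h 1‖ ^ 2 + ‖taylorCoeff g 1‖ ^ 2 + ‖taylorCoeff h n‖ ^ 2 ≤ M ^ 2 := by
  have key := le_of_forall_lt_one
    (φ := fun r => (r ^ 1 * ‖taylorCoeff h 1‖) ^ 2 + (r ^ 1 * ‖taylorCoeff g 1‖) ^ 2 +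
      (r ^ n * ‖taylorCoeff h n‖) ^ 2) (C := M ^ 2) (by fun_prop) ?_
  · simpa using key
  intro r hr0 hr1
  have hb := sum_sq_circleCoeff_le (F := fun z => h z + starRingEnd ℂ (g z))
    (hh.continuousOn.add (continuousOn_conj hg.continuousOn)) hM hr0 hr1
    {((1 : ℕ) : ℤ), -((1 : ℕ) : ℤ), (n : ℤ)}
  rw [Finset.sum_insert (by simp; omega), Finset.sum_insert (by simp),
    Finset.sum_singleton] at hb
  have e1 := circleCoeff_harmonic hh hg hr0 hr1 le_rfl
  have e2 := circleCoeff_harmonic_neg hh hg hr0 hr1 le_rfl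
  have e3 := circleCoeff_harmonic hh hg hr0 hr1 (n := n) (by omega)
  rw [e1, e2, e3] at hb
  simp only [norm_mul, norm_pow, Complex.norm_real, Real.norm_eq_abs, abs_of_pos hr0,
    RCLike.norm_conj] at hb
  linarith

lemma integral_abs_cos_add (c : ℝ) :
    ∫ θ in (0 : ℝ)..2 * Real.pi, |Real.cos (θ + c)| = 4 := by
  have hper : Function.Periodic (fun x => |Real.cos x|) (2 * Real.pi) := fun x => by
    simp [Real.cos_add_two_pi]
  have hint : ∀ a b, IntervalIntegrable (fun x => |Real.cos x|) MeasureTheory.volume a b :=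
    fun a b => (Real.continuous_cos.abs).intervalIntegrable _ _
  rw [intervalIntegral.integral_comp_add_right (fun x => |Real.cos x|), zero_add,
    add_comm _ c, hper.intervalIntegral_add_eq c (-(Real.pi / 2)),
    ← intervalIntegral.integral_add_adjacent_intervals (b := Real.pi / 2) (hint _ _) (hint _ _)]
  have h1 : ∫ x in (-(Real.pi / 2))..(Real.pi / 2), |Real.cos x| =
      ∫ x in (-(Real.pi / 2))..(Real.pi / 2), Real.cos x := by
    refine intervalIntegral.integral_congr fun x hx => ?_
    rw [uIcc_of_le (by linarith [Real.pi_pos])] at hx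
    exact abs_of_nonneg (Real.cos_nonneg_of_mem_Icc hx)
  have h2 : ∫ x in (Real.pi / 2)..(-(Real.pi / 2) + 2 * Real.pi), |Real.cos x| =
      ∫ x in (Real.pi / 2)..(-(Real.pi / 2) + 2 * Real.pi), -Real.cos x := by
    refine intervalIntegral.integral_congr fun x hx => ?_
    rw [uIcc_of_le (by linarith [Real.pi_pos])] at hx
    exact abs_of_nonpos (Real.cos_nonpos_of_pi_div_two_le_of_le hx.1 (by linarith [hx.2]))
  rw [h1, h2, integral_cos, intervalIntegral.integral_neg, integral_cos, Real.sin_add_two_pi,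
    Real.sin_neg, Real.sin_pi_div_two]
  norm_num

/-- The sharp bound `|a₁| + |b₁| ≤ 4 M / π`: after a choice of phases, the left-hand side is the
mean of the bounded function against `2 cos (θ + c)`, and `|cos|` has mean `2 / π`. -/
lemma taylorCoeff_one_add_le {h g : ℂ → ℂ} (hh : DifferentiableOn ℂ h (ball 0 1))
    (hg : DifferentiableOn ℂ g (ball 0 1)) {M : ℝ}
    (hM : ∀ z ∈ ball (0 : ℂ) 1, ‖h z + starRingEnd ℂ (g z)‖ ≤ M) :
    ‖taylorCoeff h 1‖ + ‖taylorCoeff g 1‖ ≤ 4 * M / Real.pi := by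
  have key := le_of_forall_lt_one
    (φ := fun r => r * (‖taylorCoeff h 1‖ + ‖taylorCoeff g 1‖)) (C := 4 * M / Real.pi)
    (by fun_prop) ?_
  · simpa using key
  intro r hr0 hr1
  set F : ℂ → ℂ := fun z => h z + starRingEnd ℂ (g z) with hF
  have hFc : ContinuousOn F (ball 0 1) := hh.continuousOn.add
    (continuousOn_conj hg.continuousOn)
  have hc := continuous_comp_circleMap hFc hr0 hr1
  have e1 := circleCoeff_harmonic hh hg hr0 hr1 le_rfl
  have e2 := circleCoeff_harmonic_neg hh hg hr0 hr1 le_rfl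
  rw [← hF, circleCoeff_eq] at e1 e2
  set A := taylorCoeff h 1
  set B := starRingEnd ℂ (taylorCoeff g 1) with hB
  have hBn : ‖taylorCoeff g 1‖ = ‖B‖ := by simp [hB]
  have hA' := Complex.norm_mul_exp_arg_mul_I A
  have hB' := Complex.norm_mul_exp_arg_mul_I B
  set α := A.arg
  set β := B.arg
  have hpi : (Real.pi : ℂ) ≠ 0 := by exact_mod_cast Real.pi_ne_zero
  -- combine the two coefficients with the phases that make them positive
  have hsum : ((r * (‖A‖ + ‖B‖) : ℝ) : ℂ) = (2 * Real.pi : ℂ)⁻¹ *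
      ∫ θ in (0 : ℝ)..2 * Real.pi,
        (Complex.exp (-(α * Complex.I)) * Complex.exp (-(θ * Complex.I)) +
          Complex.exp (-(β * Complex.I)) * Complex.exp (θ * Complex.I)) *
          F (circleMap 0 r θ) := by
    have hA2 : (‖A‖ : ℂ) = Complex.exp (-(α * Complex.I)) * A := by
      rw [← hA', Complex.exp_neg]
      have := Complex.exp_ne_zero (α * Complex.I)
      simp only [hA']
      field_simp
      exact hA'
    have hB2 : (‖B‖ : ℂ) = Complex.exp (-(β * Complex.I)) * B := by
      rw [← hB', Complex.exp_neg]
      have := Complex.exp_ne_zero (β * Complex.I)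
      simp only [hB']
      field_simp
      exact hB'
    have : ((r * (‖A‖ + ‖B‖) : ℝ) : ℂ) =
        Complex.exp (-(α * Complex.I)) * ((r : ℂ) ^ 1 * A) +
          Complex.exp (-(β * Complex.I)) * ((r : ℂ) ^ 1 * B) := by
      push_cast
      rw [hA2, hB2]
      ring
    rw [this, ← e1, ← e2, mul_left_comm, mul_left_comm (Complex.exp (-(β * Complex.I))),
      ← mul_add, ← intervalIntegral.integral_const_mul, ← intervalIntegral.integral_const_mul,
      ← intervalIntegral.integral_add]
    · congr 1
      refine intervalIntegral.integral_congr fun θ _ => ?_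
      simp
      ring
    · exact (continuous_const.mul (Continuous.mul (by fun_prop) hc)).intervalIntegrable _ _
    · exact (continuous_const.mul (Continuous.mul (by fun_prop) hc)).intervalIntegrable _ _
  have hpt : ∀ θ : ℝ, ‖(Complex.exp (-(α * Complex.I)) * Complex.exp (-(θ * Complex.I)) +
          Complex.exp (-(β * Complex.I)) * Complex.exp (θ * Complex.I)) *
          F (circleMap 0 r θ)‖ ≤ 2 * M * |Real.cos (θ + (α - β) / 2)| := by
    intro θ
    have h1 : Complex.exp (-(α * Complex.I)) * Complex.exp (-(θ * Complex.I)) +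
          Complex.exp (-(β * Complex.I)) * Complex.exp (θ * Complex.I) =
        Complex.exp ((-(α + β) / 2 : ℝ) * Complex.I) *
          (2 * ((Real.cos (θ + (α - β) / 2) : ℝ) : ℂ)) := by
      rw [Complex.ofReal_cos, Complex.two_cos, mul_add, ← Complex.exp_add, ← Complex.exp_add,
        ← Complex.exp_add, ← Complex.exp_add, add_comm]
      congr 2 <;> (push_cast; ring)
    rw [h1, norm_mul, norm_mul, Complex.norm_exp_ofReal_mul_I, one_mul, norm_mul,
      Complex.norm_real, Real.norm_eq_abs]
    have := hM _ (circleMap_mem_ball hr0 hr1 θ)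
    have h2 : ‖(2 : ℂ)‖ = 2 := by simp
    rw [h2]
    nlinarith [abs_nonneg (Real.cos (θ + (α - β) / 2))]
  have hnorm : r * (‖A‖ + ‖B‖) = ‖((r * (‖A‖ + ‖B‖) : ℝ) : ℂ)‖ := by
    rw [Complex.norm_real, Real.norm_eq_abs, abs_of_nonneg (by positivity)]
  have hle : ‖∫ θ in (0 : ℝ)..2 * Real.pi,
        (Complex.exp (-(α * Complex.I)) * Complex.exp (-(θ * Complex.I)) +
          Complex.exp (-(β * Complex.I)) * Complex.exp (θ * Complex.I)) *
          F (circleMap 0 r θ)‖ ≤ 2 * M * 4 := by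
    rw [← integral_abs_cos_add ((α - β) / 2), ← intervalIntegral.integral_const_mul]
    refine intervalIntegral.norm_integral_le_of_norm_le Real.two_pi_pos.le
      (Filter.Eventually.of_forall fun θ _ => hpt θ) ?_
    exact Continuous.intervalIntegrable (by fun_prop) _ _
  change r * (‖A‖ + ‖taylorCoeff g 1‖) ≤ _
  rw [hBn, hnorm, hsum, norm_mul, norm_inv, norm_mul, Complex.norm_real, Real.norm_eq_abs,
    abs_of_pos Real.pi_pos, Complex.norm_ofNat, inv_mul_le_iff₀ Real.two_pi_pos]
  refine hle.trans (le_of_eq ?_)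
  field_simp

/-! ### Products of a radial power and a perturbed linear map -/

section Perturbation

variable {V : Type*} [NormedAddCommGroup V] [InnerProductSpace ℝ V]

lemma norm_add_norm_le_sqrt_two_mul {u v : V} (h : 0 ≤ inner ℝ u v) :
    ‖u‖ + ‖v‖ ≤ √2 * ‖u + v‖ := by
  refine (sq_le_sq₀ (by positivity) (by positivity)).mp ?_
  rw [mul_pow, Real.sq_sqrt zero_le_two, norm_add_sq_real]
  nlinarith [sq_nonneg (‖u‖ - ‖v‖)]

/-- If `L u + L v` is small compared with `‖u‖ + ‖v‖` and the angle between `u` and `v` is at most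
a right angle, then `u = v = 0`. -/
lemma norm_add_norm_eq_zero {L : V →L[ℝ] V} {lam ε : ℝ} (hε : 0 ≤ ε) (hlam : √2 * ε < lam)
    (hL : ∀ v, lam * ‖v‖ ≤ ‖L v‖) {u v : V} (h : 0 ≤ inner ℝ u v)
    (huv : ‖L (u + v)‖ ≤ ε * (‖u‖ + ‖v‖)) : u = 0 ∧ v = 0 := by
  have h1 := norm_add_norm_le_sqrt_two_mul h
  have h2 := (hL (u + v)).trans huv
  have h3 : ‖u + v‖ = 0 := by
    by_contra hne
    have hpos : 0 < ‖u + v‖ := lt_of_le_of_ne (norm_nonneg _) (Ne.symm hne)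
    nlinarith
  rw [h3, mul_zero] at h1
  have hu := norm_nonneg u
  have hv := norm_nonneg v
  exact ⟨norm_eq_zero.mp (by linarith), norm_eq_zero.mp (by linarith)⟩

/-- A map `Φ` that is Lipschitz close to an expanding linear map `L` stays injective after
multiplication by a power of the norm. If `‖x‖ ≤ ‖y‖` have the same image, then
`Φ y = t Φ x` with `t ≤ 1`, so that `L (t (y - x) + (1 - t) y)` is small, while the angle between
`y - x` and `y` is at most a right angle. -/
lemma injOn_norm_pow_smul {Φ : V → V} {L : V →L[ℝ] V} {lam ε ρ : ℝ} (hε : 0 ≤ ε)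
    (hlam : √2 * ε < lam) (hL : ∀ v, lam * ‖v‖ ≤ ‖L v‖) (hΦ0 : Φ 0 = 0)
    (hE : ∀ x ∈ ball (0 : V) ρ, ∀ y ∈ ball (0 : V) ρ,
      ‖(Φ x - L x) - (Φ y - L y)‖ ≤ ε * ‖x - y‖) (q : ℕ) :
    InjOn (fun z => ‖z‖ ^ q • Φ z) (ball 0 ρ) := by
  suffices H : ∀ x ∈ ball (0 : V) ρ, ∀ y ∈ ball (0 : V) ρ, ‖x‖ ≤ ‖y‖ →
      ‖x‖ ^ q • Φ x = ‖y‖ ^ q • Φ y → x = y by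
    intro x hx y hy hxy
    rcases le_total ‖x‖ ‖y‖ with h | h
    · exact H x hx y hy h hxy
    · exact (H y hy x hx h hxy.symm).symm
  intro x hx y hy hle hxy
  by_cases hy0 : y = 0
  · subst hy0
    simpa using hle
  have hyn : 0 < ‖y‖ := norm_pos_iff.mpr hy0
  set t : ℝ := (‖x‖ / ‖y‖) ^ q with ht
  have ht0 : 0 ≤ t := by positivity
  have ht1 : t ≤ 1 := pow_le_one₀ (by positivity) ((div_le_one hyn).mpr hle)
  have hΦ : Φ y = t • Φ x := by
    rw [ht, div_pow, div_eq_inv_mul, mul_smul, hxy, smul_smul, inv_mul_cancel₀ (by positivity),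
      one_smul]
  have hρ : 0 < ρ := pos_of_mem_ball hy
  have hEy := hE y hy 0 (mem_ball_self hρ)
  have hEyx := hE y hy x hx
  simp only [hΦ0, map_zero, sub_zero] at hEy
  have hinner : 0 ≤ inner ℝ (t • (y - x)) ((1 - t) • y) := by
    rw [real_inner_smul_left, real_inner_smul_right, inner_sub_left, real_inner_self_eq_norm_sq]
    have := real_inner_le_norm x y
    have h2 : 0 ≤ ‖y‖ ^ 2 - inner ℝ x y := by nlinarith
    exact mul_nonneg ht0 (mul_nonneg (by linarith) h2)
  have hnu : ‖t • (y - x)‖ = t * ‖y - x‖ := by rw [norm_smul, Real.norm_of_nonneg ht0]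
  have hnv : ‖(1 - t) • y‖ = (1 - t) * ‖y‖ := by
    rw [norm_smul, Real.norm_of_nonneg (by linarith)]
  have hkey : L (t • (y - x) + (1 - t) • y) =
      -(t • ((Φ y - L y) - (Φ x - L x)) + (1 - t) • (Φ y - L y)) := by
    simp only [map_add, map_smul, map_sub, hΦ]
    module
  obtain ⟨hu, hv⟩ := norm_add_norm_eq_zero hε hlam hL hinner (by
    rw [hkey, norm_neg, hnu, hnv]
    refine (norm_add_le _ _).trans ?_
    rw [norm_smul, norm_smul, Real.norm_of_nonneg ht0,
      Real.norm_of_nonneg (by linarith : 0 ≤ 1 - t)]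
    nlinarith [mul_le_mul_of_nonneg_left hEyx ht0,
      mul_le_mul_of_nonneg_left hEy (by linarith : 0 ≤ 1 - t)])
  have ht1' : t = 1 := by
    rcases smul_eq_zero.mp hv with h | h
    · linarith
    · exact absurd h hy0
  rw [ht1', one_smul, sub_eq_zero] at hu
  exact hu.symm

/-- The derivative of a radial power times `Φ`. -/
lemma hasStrictFDerivAt_norm_pow_smul {Φ : V → V} {Φ' : V →L[ℝ] V} {z : V}
    (hΦ : HasStrictFDerivAt Φ Φ' z) (m : ℕ) :
    ∃ c : ℝ, 0 ≤ c ∧ HasStrictFDerivAt (fun x => ‖x‖ ^ (2 * m) • Φ x)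
      (‖z‖ ^ (2 * m) • Φ' + (c • innerSL ℝ z).smulRight (Φ z)) z := by
  refine ⟨m * (‖z‖ ^ 2) ^ (m - 1) * 2, by positivity, ?_⟩
  have h1 : HasStrictFDerivAt (fun x : V => ‖x‖ ^ 2) (2 • innerSL ℝ z) z := 
    hasStrictFDerivAt_norm_sq z
  have h2 := (h1.pow m).smul hΦ
  simp only [← pow_mul] at h2
  refine h2.congr_fderiv ?_
  ext v
  simp only [add_apply, ContinuousLinearMap.smulRight_apply,
    smul_apply, nsmul_eq_mul, smul_eq_mul, pow_mul]
  congr 2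
  push_cast
  ring

/-- The derivative of a radial power times `Φ` is injective away from the origin. -/
lemma injective_fderiv_norm_pow_smul {Φ : V → V} {Φ' L : V →L[ℝ] V} {z : V} {lam ε c : ℝ}
    (hε : 0 ≤ ε) (hlam : √2 * ε < lam) (hL : ∀ v, lam * ‖v‖ ≤ ‖L v‖) (hz : z ≠ 0) (hc : 0 ≤ c)
    (hE : ‖Φ z - L z‖ ≤ ε * ‖z‖) (hE' : ∀ v, ‖Φ' v - L v‖ ≤ ε * ‖v‖) (q : ℕ) :
    Function.Injective (‖z‖ ^ q • Φ' + (c • innerSL ℝ z).smulRight (Φ z)) := by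
  have hzq : 0 < ‖z‖ ^ q := pow_pos (norm_pos_iff.mpr hz) q
  suffices H : ∀ v, 0 ≤ inner ℝ v z →
      (‖z‖ ^ q • Φ' + (c • innerSL ℝ z).smulRight (Φ z)) v = 0 → v = 0 by
    refine (injective_iff_map_eq_zero _).mpr fun v hv => ?_
    rcases le_total 0 (inner ℝ v z) with h | h
    · exact H v h hv
    · refine neg_eq_zero.mp (H (-v) ?_ ?_)
      · rw [inner_neg_left]
        linarith
      · rw [map_neg, hv, neg_zero]
  intro v hv h0
  set τ : ℝ := c * inner ℝ v z / ‖z‖ ^ q with hτ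
  have hτ0 : 0 ≤ τ := by positivity
  have h1 : Φ' v + τ • Φ z = 0 := by
    have h2 : ‖z‖ ^ q • (Φ' v + τ • Φ z) = 0 := by
      rw [← h0, smul_add, smul_smul, hτ, mul_div_cancel₀ _ hzq.ne']
      simp [real_inner_comm]
    exact (smul_eq_zero.mp h2).resolve_left hzq.ne'
  have hkey : L (v + τ • z) = -((Φ' v - L v) + τ • (Φ z - L z)) := by
    rw [map_add, map_smul, eq_neg_iff_add_eq_zero, ← h1]
    module
  refine (norm_add_norm_eq_zero hε hlam hL (u := v) (v := τ • z) ?_ ?_).1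
  · rw [real_inner_smul_right]
    exact mul_nonneg hτ0 hv
  · rw [hkey, norm_neg, norm_smul, Real.norm_of_nonneg hτ0]
    refine (norm_add_le _ _).trans ?_
    rw [norm_smul, Real.norm_of_nonneg hτ0]
    nlinarith [hE' v, mul_le_mul_of_nonneg_left hE hτ0]

end Perturbation

/-- A punctured disk is connected, being the image of a half-plane under `exp`. -/
lemma isPreconnected_ball_diff_zero (R : ℝ) : IsPreconnected (ball (0 : ℂ) R \ {0}) := by
  rcases le_or_gt R 0 with hR | hR
  · simp [ball_eq_empty.mpr hR, isPreconnected_empty]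
  have himg : ball (0 : ℂ) R \ {0} = Complex.exp '' {z | z.re < Real.log R} := by
    ext w
    simp only [mem_sdiff, mem_ball_zero_iff, mem_singleton_iff, mem_image, mem_ofPred_eq]
    constructor
    · rintro ⟨hw, hw0⟩
      refine ⟨Complex.log w, ?_, Complex.exp_log hw0⟩
      rw [Complex.log_re]
      exact Real.log_lt_log (norm_pos_iff.mpr hw0) hw
    · rintro ⟨z, hz, rfl⟩
      refine ⟨?_, Complex.exp_ne_zero z⟩
      rw [Complex.norm_exp]
      exact (Real.lt_log_iff_exp_lt hR).mp hz
  rw [himg]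
  exact (convex_halfSpace_re_lt _).isPreconnected.image _ Complex.continuous_exp.continuousOn

/-- A covering theorem: the image contains the disk whose radius is the lower bound of the map on
the boundary circle. Inside that disk minus the origin, the image of the punctured disk is open, by
the inverse function theorem, and relatively closed, by compactness. -/
lemma ball_subset_image_norm_pow_smul {Φ : ℂ → ℂ} {L : ℂ →L[ℝ] ℂ} {lam ε ρ κ : ℝ} (hρ : 0 < ρ)
    (hε : 0 ≤ ε) (hlam : √2 * ε < lam) (hL : ∀ v, lam * ‖v‖ ≤ ‖L v‖) (hΦ0 : Φ 0 = 0)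
    (hE : ∀ x ∈ ball (0 : ℂ) ρ, ∀ y ∈ ball (0 : ℂ) ρ,
      ‖(Φ x - L x) - (Φ y - L y)‖ ≤ ε * ‖x - y‖)
    (hd : ∀ z ∈ ball (0 : ℂ) ρ, ∃ Φ' : ℂ →L[ℝ] ℂ, HasStrictFDerivAt Φ Φ' z)
    (hc : ContinuousOn Φ (closedBall 0 ρ)) (hκ : ∀ z, ‖z‖ = ρ → κ ≤ ‖Φ z‖) (m : ℕ) :
    ball (0 : ℂ) (ρ ^ (2 * m) * κ) ⊆ (fun z => ‖z‖ ^ (2 * m) • Φ z) '' ball 0 ρ := by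
  set F : ℂ → ℂ := fun z => ‖z‖ ^ (2 * m) • Φ z with hF
  set R := ρ ^ (2 * m) * κ with hR
  rcases le_or_gt R 0 with hR0 | hR0
  · simp [ball_eq_empty.mpr hR0]
  have hF0 : F 0 = 0 := by simp [hF, hΦ0]
  have hFinj : InjOn F (ball 0 ρ) := injOn_norm_pow_smul hε hlam hL hΦ0 hE (2 * m)
  have hFc : ContinuousOn F (closedBall 0 ρ) :=
    (continuous_norm.pow _).continuousOn.smul hc
  have h0mem : (0 : ℂ) ∈ ball (0 : ℂ) ρ := mem_ball_self hρ
  have hFne : ∀ z ∈ ball (0 : ℂ) ρ, z ≠ 0 → F z ≠ 0 := fun z hz hz0 h =>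
    hz0 (hFinj hz h0mem (h.trans hF0.symm))
  set U := F '' (ball 0 ρ \ {0}) with hU
  have hUopen : IsOpen U := by
    refine isOpen_iff_mem_nhds.mpr ?_
    rintro _ ⟨z, ⟨hz, hz0⟩, rfl⟩
    obtain ⟨Φ', hΦ'⟩ := hd z hz
    obtain ⟨c, hc0, hder⟩ := hasStrictFDerivAt_norm_pow_smul hΦ' m
    have hE' : ∀ v, ‖Φ' v - L v‖ ≤ ε * ‖v‖ := by
      have h1 : HasFDerivAt (fun x => Φ x - L x) (Φ' - L) z :=
        hΦ'.hasFDerivAt.sub L.hasFDerivAt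
      have h2 : ‖Φ' - L‖ ≤ ε := by
        refine h1.le_of_lip' hε ?_
        filter_upwards [isOpen_ball.mem_nhds hz] with x hx using hE x hx z hz
      exact fun v => (Φ' - L).le_of_opNorm_le h2 v
    have hEz : ‖Φ z - L z‖ ≤ ε * ‖z‖ := by simpa [hΦ0] using hE z hz 0 h0mem
    have hinj := injective_fderiv_norm_pow_smul hε hlam hL hz0 hc0 hEz hE' (2 * m)
    have hsurj := LinearMap.injective_iff_surjective.mp
      (show Function.Injective (‖z‖ ^ (2 * m) • Φ' +
        (c • innerSL ℝ z).smulRight (Φ z)).toLinearMap from hinj)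
    rw [← hder.map_nhds_eq_of_surj (LinearMap.range_eq_top.mpr hsurj)]
    exact Filter.image_mem_map ((isOpen_ball.sdiff isClosed_singleton).mem_nhds ⟨hz, hz0⟩)
  have hnonempty : ((ball (0 : ℂ) R \ {0}) ∩ U).Nonempty := by
    have hcont : ContinuousAt F 0 := hFc.continuousAt (closedBall_mem_nhds 0 hρ)
    have hev : ∀ᶠ z in nhds (0 : ℂ), F z ∈ ball (0 : ℂ) R ∧ z ∈ ball (0 : ℂ) ρ :=
      (hcont.eventually_mem (by rw [hF0]; exact ball_mem_nhds 0 hR0)).and (ball_mem_nhds 0 hρ)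
    obtain ⟨z, ⟨hz1, hz2⟩, hz0⟩ :=
      ((hev.filter_mono nhdsWithin_le_nhds).and
        (self_mem_nhdsWithin : {(0 : ℂ)}ᶜ ∈ nhdsWithin 0 {0}ᶜ)).exists
    exact ⟨F z, ⟨hz1, hFne z hz2 hz0⟩, z, ⟨hz2, hz0⟩, rfl⟩
  have hclosed : closure U ∩ (ball (0 : ℂ) R \ {0}) ⊆ U := by
    rintro w ⟨hw, hwR, hw0⟩
    have hK : IsClosed (F '' closedBall 0 ρ) :=
      ((isCompact_closedBall 0 ρ).image_of_continuousOn hFc).isClosed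
    have hsub : U ⊆ F '' closedBall 0 ρ :=
      image_mono (sdiff_subset.trans ball_subset_closedBall)
    obtain ⟨z, hz, rfl⟩ := closure_minimal hsub hK hw
    have hz0 : z ≠ 0 := by
      rintro rfl
      exact hw0 hF0
    refine ⟨z, ⟨?_, hz0⟩, rfl⟩
    rw [mem_closedBall_zero_iff] at hz
    rw [mem_ball_zero_iff] at hwR ⊢
    refine lt_of_le_of_ne hz fun hzρ => ?_
    have : R ≤ ‖F z‖ := by
      simp only [hF, norm_smul, norm_pow, hzρ, hR, Real.norm_of_nonneg hρ.le]
      exact mul_le_mul_of_nonneg_left (hκ z hzρ) (by positivity)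
    linarith
  have hmain := (isPreconnected_ball_diff_zero R).subset_of_closure_inter_subset hUopen
    hnonempty hclosed
  intro w hw
  by_cases hw0 : w = 0
  · exact ⟨0, h0mem, by rw [hw0]; exact hF0⟩
  · obtain ⟨z, hz, rfl⟩ := hmain ⟨hw, hw0⟩
    exact ⟨z, hz.1, rfl⟩

/-! ### The constants and the radius -/

lemma landauS0_gt : 4 < landauS0 := by
  have h1 : (4.12 : ℝ) ≤ √17 := Real.le_sqrt_of_sq_le (by norm_num)
  have h2 : √17 ≤ (4.125 : ℝ) := Real.sqrt_le_iff.mpr ⟨by norm_num, by norm_num⟩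
  have h3 : (2.75 : ℝ) ≤ (√17 - 1) / (√17 - 3) := by
    rw [le_div_iff₀ (by linarith)]
    linarith
  have h4 : (1.5 : ℝ) ≤ √(2 / (5 - √17)) := by
    refine Real.le_sqrt_of_sq_le ?_
    rw [le_div_iff₀ (by linarith)]
    linarith
  rw [landauS0]
  nlinarith

lemma landauT_nonneg {M : ℝ} (hM : 0 ≤ M) : 0 ≤ landauT M := by
  have := Real.pi_pos
  rw [landauT]
  split_ifs <;> positivity

lemma landauLambda0_pos {M : ℝ} (hM : 1 ≤ M) : 0 < landauLambda0 M := by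
  have := Real.pi_pos
  rw [landauLambda0]
  split_ifs <;> positivity

lemma landauLambda0_le_one {M : ℝ} (hM : 1 ≤ M) : landauLambda0 M ≤ 1 := by
  rw [landauLambda0]
  split_ifs
  · have h1 : √2 ≤ √(M ^ 2 + 1) := Real.sqrt_le_sqrt (by nlinarith)
    refine div_le_one_of_le₀ ?_ (by positivity)
    linarith [Real.sqrt_nonneg (M ^ 2 - 1)]
  · refine div_le_one_of_le₀ ?_ (by positivity)
    linarith [Real.pi_le_four]

/-- The lower bound `λ₀(M)` for the smallest stretching `A - B = 1 / (A + B)` follows from the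
Parseval bound below the threshold, and from the sharp bound for `A + B` above it. -/
lemma landauLambda0_le_sub {M A B : ℝ} (hA : 0 ≤ A) (hB : 0 ≤ B) (hM : 1 ≤ M)
    (hJ : A ^ 2 - B ^ 2 = 1) (h2 : A ^ 2 + B ^ 2 ≤ M ^ 2) (h1 : A + B ≤ 4 * M / Real.pi) :
    landauLambda0 M ≤ A - B := by
  have hpi := Real.pi_pos
  have hpos : 0 < A + B := by
    rcases hA.eq_or_lt with h | h
    · subst h
      nlinarith
    · linarith
  have hsub : A - B = 1 / (A + B) := by
    rw [eq_div_iff hpos.ne']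
    linarith
  rw [hsub, landauLambda0]
  split_ifs
  · have h3 : √2 * A ≤ √(M ^ 2 + 1) := by
      refine Real.le_sqrt_of_sq_le ?_
      rw [mul_pow, Real.sq_sqrt zero_le_two]
      linarith
    have h4 : √2 * B ≤ √(M ^ 2 - 1) := by
      refine Real.le_sqrt_of_sq_le ?_
      rw [mul_pow, Real.sq_sqrt zero_le_two]
      linarith
    rw [div_le_div_iff₀ (by positivity) hpos]
    linarith
  · rw [div_le_div_iff₀ (by positivity) hpos]
    rw [le_div_iff₀ hpi] at h1
    linarith

lemma mul_le_arctan {r : ℝ} (h0 : 0 ≤ r) (h1 : r ≤ 1 / 10) : 0.99 * r ≤ Real.arctan r := by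
  have h2 : Real.sin (Real.arctan r) ≤ Real.arctan r := Real.sin_le (Real.arctan_nonneg.mpr h0)
  rw [Real.sin_arctan] at h2
  refine le_trans ?_ h2
  have h3 : √(1 + r ^ 2) ≤ 1.005 := Real.sqrt_le_iff.mpr ⟨by norm_num, by nlinarith⟩
  rw [le_div_iff₀ (by positivity)]
  nlinarith

/-- A linear lower bound for the term `(16 M / π²) s₀ arctan r`. -/
lemma mul_le_landau_arctan {M r : ℝ} (hM : 0 ≤ M) (h0 : 0 ≤ r) (h1 : r ≤ 1 / 10) :
    6.4 * M * r ≤ 16 * M / Real.pi ^ 2 * landauS0 * Real.arctan r := by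
  have hpi := Real.pi_pos
  have hpi2 : Real.pi ^ 2 ≤ 9.87 := by nlinarith [Real.pi_lt_d4]
  have h2 : 6.48 * M ≤ 16 * M / Real.pi ^ 2 * landauS0 := by
    rw [div_mul_eq_mul_div, le_div_iff₀ (by positivity)]
    nlinarith [landauS0_gt]
  calc 6.4 * M * r ≤ 6.48 * M * (0.99 * r) := by nlinarith [mul_nonneg hM h0]
    _ ≤ _ := mul_le_mul h2 (mul_le_arctan h0 h1) (by positivity) (le_trans (by positivity) h2)

lemma strictAntiOn_landauEq {M : ℝ} (hM : 1 ≤ M) : StrictAntiOn (landauEq M) (Ico 0 1) := by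
  intro x hx y hy hxy
  have hpi := Real.pi_pos
  have hS : 0 < 48 * M / Real.pi ^ 2 * landauS0 := by
    have := landauS0_gt
    positivity
  have hT := landauT_nonneg (zero_le_one.trans hM)
  have h1 := mul_lt_mul_of_pos_left (Real.arctan_strictMono hxy) hS
  have h2 : 2 * landauT M * x / (1 - x) ^ 3 ≤ 2 * landauT M * y / (1 - y) ^ 3 := by
    have hy1 : 0 < 1 - y := by linarith [hy.2]
    have hx0 := hx.1
    have hy0 := hy.1
    gcongr
  simp only [landauEq]
  linarith

/-- The equation for `ρ` has a root, and it is at most `1 / 10`. -/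
lemma exists_landauEq_eq_zero {M : ℝ} (hM : 1 ≤ M) :
    ∃ ρ : ℝ, 0 < ρ ∧ ρ ≤ 1 / 10 ∧ landauEq M ρ = 0 := by
  have hT := landauT_nonneg (zero_le_one.trans hM)
  have h0 : 0 < landauEq M 0 := by simpa [landauEq] using landauLambda0_pos hM
  have h1 : landauEq M (1 / 10) ≤ 0 := by
    have h2 := mul_le_landau_arctan (zero_le_one.trans hM) (r := 1 / 10) (by norm_num) le_rfl
    have h3 := landauLambda0_le_one hM
    have h4 : 0 ≤ 2 * landauT M * (1 / 10) / (1 - 1 / 10) ^ 3 := by positivity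
    have h5 : 48 * M / Real.pi ^ 2 * landauS0 * Real.arctan (1 / 10) =
        3 * (16 * M / Real.pi ^ 2 * landauS0 * Real.arctan (1 / 10)) := by ring
    rw [landauEq, h5]
    linarith
  have hc : ContinuousOn (landauEq M) (Icc 0 (1 / 10)) := by
    unfold landauEq
    refine ContinuousOn.sub (by fun_prop) (ContinuousOn.div (by fun_prop) (by fun_prop) ?_)
    intro x hx
    have : 0 < 1 - x := by linarith [hx.2]
    positivity
  obtain ⟨ρ, hρ, hρ0⟩ := intermediate_value_Icc' (by norm_num) hc ⟨h1, h0.le⟩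
  refine ⟨ρ, lt_of_le_of_ne hρ.1 ?_, hρ.2, hρ0⟩
  rintro rfl
  exact h0.ne' hρ0

/-! ### Bounded harmonic functions on the unit disk -/

/-- A complex-valued harmonic function on the unit disk is `h + conj g` with `h`, `g`
holomorphic. -/
lemma exists_eq_add_conj {G : ℂ → ℂ} (hG : InnerProductSpace.HarmonicOnNhd G (ball (0 : ℂ) 1)) :
    ∃ h g : ℂ → ℂ, DifferentiableOn ℂ h (ball 0 1) ∧ DifferentiableOn ℂ g (ball 0 1) ∧
      ∀ z ∈ ball (0 : ℂ) 1, G z = h z + starRingEnd ℂ (g z) := by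
  obtain ⟨P, hP, hPe⟩ := (hG.comp_CLM Complex.reCLM).exists_analyticOnNhd_ball_re_eq
  obtain ⟨Q, hQ, hQe⟩ := (hG.comp_CLM Complex.imCLM).exists_analyticOnNhd_ball_re_eq
  have hP' := hP.differentiableOn
  have hQ' := hQ.differentiableOn
  refine ⟨fun z => (P z + Complex.I * Q z) / 2, fun z => (P z - Complex.I * Q z) / 2,
    by fun_prop, by fun_prop, fun z hz => ?_⟩
  have h1 : (P z).re = (G z).re := hPe hz
  have h2 : (Q z).re = (G z).im := hQe hz
  apply Complex.ext <;> simp [Complex.conj_ofNat] <;> linarith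

lemma taylorCoeff_one (h : ℂ → ℂ) : taylorCoeff h 1 = deriv h 0 := by
  simp [taylorCoeff]

lemma differentiableOn_deriv_ball {h : ℂ → ℂ} (hh : DifferentiableOn ℂ h (ball 0 1)) :
    DifferentiableOn ℂ (deriv h) (ball 0 1) := hh.deriv isOpen_ball

/-- The second derivative is dominated by `∑ (n + 2) (n + 1) M ‖z‖ ^ n = 2 M / (1 - ‖z‖) ^ 3`, and
`2 / (9 / 10) ^ 3 < 11 / 4`. -/
lemma norm_deriv_deriv_le {h : ℂ → ℂ} (hh : DifferentiableOn ℂ h (ball 0 1)) {M : ℝ} (hM : 0 ≤ M)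
    (hc : ∀ n, 2 ≤ n → ‖taylorCoeff h n‖ ≤ M) {z : ℂ} (hz : ‖z‖ ≤ 1 / 10) :
    ‖deriv (deriv h) z‖ ≤ 11 / 4 * M := by
  have hz1 : ‖z‖ < 1 := by linarith
  have hd2 := differentiableOn_deriv_ball (differentiableOn_deriv_ball hh)
  have hs := Complex.hasSum_taylorSeries_on_ball hd2 (mem_ball_zero_iff.mpr hz1)
  have hgeo := (hasSum_choose_mul_geometric_of_norm_lt_one 2 (r := ‖z‖)
    (by simpa using hz1)).mul_left (2 * M)
  refine (hs.norm_le_of_bounded hgeo fun n => ?_).trans ?_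
  · rw [← iteratedDeriv_succ', ← iteratedDeriv_succ', sub_zero]
    have hcn := hc (n + 2) (by omega)
    have hfac : (((n + 2).factorial : ℕ) : ℝ) = 2 * ((n + 2).choose 2) * (n.factorial : ℝ) := by
      have := Nat.choose_mul_factorial_mul_factorial (n := n + 2) (k := 2) (by omega)
      rw [Nat.add_sub_cancel] at this
      rw [← this]
      push_cast [Nat.factorial]
      ring
    have hn : (0 : ℝ) < n.factorial := by positivity
    have hn2 : (0 : ℝ) < (n + 2).factorial := by positivity
    rw [taylorCoeff, norm_div, Complex.norm_natCast, div_le_iff₀ hn2, hfac] at hcn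
    rw [norm_smul, norm_smul, norm_inv, Complex.norm_natCast, norm_pow,
      inv_mul_le_iff₀ hn]
    calc ‖z‖ ^ n * ‖iteratedDeriv (n + 2) h 0‖
        ≤ ‖z‖ ^ n * (M * (2 * ((n + 2).choose 2) * (n.factorial : ℝ))) := by gcongr
      _ = _ := by ring
  · have h3 : (9 / 10 : ℝ) ^ (2 + 1) ≤ (1 - ‖z‖) ^ (2 + 1) :=
      pow_le_pow_left₀ (by norm_num) (by linarith) _
    calc 2 * M * (1 / (1 - ‖z‖) ^ (2 + 1)) ≤ 2 * M * (1 / (9 / 10 : ℝ) ^ (2 + 1)) := by gcongr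
      _ ≤ 11 / 4 * M := by
        norm_num
        linarith

lemma norm_deriv_sub_le {h : ℂ → ℂ} (hh : DifferentiableOn ℂ h (ball 0 1)) {M : ℝ} (hM : 0 ≤ M)
    (hc : ∀ n, 2 ≤ n → ‖taylorCoeff h n‖ ≤ M) {z : ℂ} (hz : ‖z‖ ≤ 1 / 10) :
    ‖deriv h z - deriv h 0‖ ≤ 11 / 4 * M * ‖z‖ := by
  have hsub : closedBall (0 : ℂ) (1 / 10) ⊆ ball 0 1 := closedBall_subset_ball (by norm_num)
  have := (convex_closedBall (0 : ℂ) (1 / 10)).norm_image_sub_le_of_norm_deriv_le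
    (f := deriv h) (C := 11 / 4 * M) (x := 0) (y := z)
    (fun x hx => (differentiableOn_deriv_ball hh).differentiableAt (isOpen_ball.mem_nhds (hsub hx)))
    (fun x hx => norm_deriv_deriv_le hh hM hc (mem_closedBall_zero_iff.mp hx))
    (by simp) (mem_closedBall_zero_iff.mpr hz)
  simpa using this

/-- The remainder `z (h'(z) - h'(0))` is Lipschitz with a constant proportional to the radius. -/
lemma norm_mul_deriv_sub_le {h : ℂ → ℂ} (hh : DifferentiableOn ℂ h (ball 0 1)) {M : ℝ}
    (hM : 0 ≤ M) (hc : ∀ n, 2 ≤ n → ‖taylorCoeff h n‖ ≤ M) {ρ : ℝ} (hρ : ρ ≤ 1 / 10)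
    {x y : ℂ} (hx : x ∈ ball (0 : ℂ) ρ) (hy : y ∈ ball (0 : ℂ) ρ) :
    ‖x * (deriv h x - deriv h 0) - y * (deriv h y - deriv h 0)‖ ≤
      11 / 2 * M * ρ * ‖x - y‖ := by
  have hsub : ball (0 : ℂ) ρ ⊆ ball 0 1 := ball_subset_ball (by linarith)
  have hder : ∀ z ∈ ball (0 : ℂ) ρ, HasDerivAt (fun z => z * (deriv h z - deriv h 0))
      (1 * (deriv h z - deriv h 0) + z * deriv (deriv h) z) z := fun z hz =>
    (hasDerivAt_id z).mul ((((differentiableOn_deriv_ball hh).differentiableAt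
      (isOpen_ball.mem_nhds (hsub hz))).hasDerivAt).sub_const _)
  refine (convex_ball (0 : ℂ) ρ).norm_image_sub_le_of_norm_hasDerivWithin_le
    (fun z hz => (hder z hz).hasDerivWithinAt) (fun z hz => ?_) hy hx
  have hzρ : ‖z‖ < ρ := mem_ball_zero_iff.mp hz
  have hz : ‖z‖ ≤ 1 / 10 := by linarith
  have h1 := norm_deriv_sub_le hh hM hc hz
  have h2 := norm_deriv_deriv_le hh hM hc hz
  rw [one_mul]
  refine (norm_add_le _ _).trans ?_
  rw [norm_mul]
  have h3 : ‖z‖ * ‖deriv (deriv h) z‖ ≤ ‖z‖ * (11 / 4 * M) :=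
    mul_le_mul_of_nonneg_left h2 (norm_nonneg z)
  have h4 : ‖z‖ * M ≤ ρ * M := mul_le_mul_of_nonneg_right hzρ.le hM
  linarith

/-! ### The operator `D` -/

/-- `D` is the derivative along rotations, up to the factor `-i`. -/
lemma opD_eq (f : ℂ → ℂ) (z : ℂ) :
    opD f z = -Complex.I * fderiv ℝ f z (Complex.I * z) := by
  have h1 : Complex.I * z = (-z.im) • (1 : ℂ) + z.re • Complex.I := by
    apply Complex.ext <;> simp
  have h2 : starRingEnd ℂ z = z.re - z.im * Complex.I := by
    apply Complex.ext <;> simp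
  rw [h1, map_add, map_smul, map_smul, opD, wirtingerDz, wirtingerDzbar, h2]
  nth_rewrite 1 [← Complex.re_add_im z]
  simp only [Complex.real_smul]
  push_cast
  ring

/-- The function `z h' - conj (z g')`, which is the image of `h + conj g` under `D`. -/
noncomputable def harmonicD (h g : ℂ → ℂ) (z : ℂ) : ℂ :=
  z * deriv h z - starRingEnd ℂ (z * deriv g z)

/-- The real-linear map `v ↦ a v + conj (b v)`. -/
noncomputable def mulAddConj (a b : ℂ) : ℂ →L[ℝ] ℂ :=
  ContinuousLinearMap.mul ℝ ℂ a +
    (Complex.conjCLE : ℂ →L[ℝ] ℂ).comp (ContinuousLinearMap.mul ℝ ℂ b)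

@[simp] lemma mulAddConj_apply (a b v : ℂ) :
    mulAddConj a b v = a * v + starRingEnd ℂ (b * v) := by
  simp [mulAddConj]

lemma le_norm_mulAddConj (a b v : ℂ) : (‖a‖ - ‖b‖) * ‖v‖ ≤ ‖mulAddConj a b v‖ := by
  rw [mulAddConj_apply]
  have := norm_sub_le (a * v + starRingEnd ℂ (b * v)) (starRingEnd ℂ (b * v))
  rw [add_sub_cancel_right, RCLike.norm_conj, norm_mul, norm_mul] at this
  linarith

lemma hasStrictFDerivAt_add_conj {h g : ℂ → ℂ} {h' g' z : ℂ} (hh : HasStrictDerivAt h h' z)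
    (hg : HasStrictDerivAt g g' z) :
    HasStrictFDerivAt (fun z => h z + starRingEnd ℂ (g z)) (mulAddConj h' g') z := by
  have h1 := hh.hasStrictFDerivAt.restrictScalars ℝ
  have h2 := (Complex.conjCLE : ℂ →L[ℝ] ℂ).hasStrictFDerivAt.comp z
    (hg.hasStrictFDerivAt.restrictScalars ℝ)
  refine (h1.add h2).congr_fderiv ?_
  ext v
  simp [mul_comm]

lemma hasStrictDerivAt_of_differentiableOn {h : ℂ → ℂ} (hh : DifferentiableOn ℂ h (ball 0 1))
    {z : ℂ} (hz : z ∈ ball (0 : ℂ) 1) : HasStrictDerivAt h (deriv h z) z :=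
  (hh.analyticAt (isOpen_ball.mem_nhds hz)).hasStrictDerivAt

lemma exists_hasStrictFDerivAt_harmonicD {h g : ℂ → ℂ} (hh : DifferentiableOn ℂ h (ball 0 1))
    (hg : DifferentiableOn ℂ g (ball 0 1)) {z : ℂ} (hz : z ∈ ball (0 : ℂ) 1) :
    ∃ Φ' : ℂ →L[ℝ] ℂ, HasStrictFDerivAt (harmonicD h g) Φ' z := by
  have h1 := hasStrictDerivAt_of_differentiableOn
    (differentiableOn_id.mul (differentiableOn_deriv_ball hh)) hz
  have h2 := hasStrictDerivAt_of_differentiableOn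
    (differentiableOn_id.mul (differentiableOn_deriv_ball hg)).neg hz
  refine ⟨_, (hasStrictFDerivAt_add_conj h1 h2).congr_of_eventuallyEq
    (Filter.Eventually.of_forall fun x => ?_)⟩
  simp [harmonicD, sub_eq_add_neg]

lemma jacobianC_add_conj {G h g : ℂ → ℂ} {z : ℂ} (hz : z ∈ ball (0 : ℂ) 1)
    (hh : DifferentiableOn ℂ h (ball 0 1)) (hg : DifferentiableOn ℂ g (ball 0 1))
    (hG : ∀ z ∈ ball (0 : ℂ) 1, G z = h z + starRingEnd ℂ (g z)) :
    jacobianC G z = ‖deriv h z‖ ^ 2 - ‖deriv g z‖ ^ 2 := by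
  have h1 := hasStrictFDerivAt_add_conj (hasStrictDerivAt_of_differentiableOn hh hz)
    (hasStrictDerivAt_of_differentiableOn hg hz)
  have h2 : fderiv ℝ G z = mulAddConj (deriv h z) (deriv g z) := by
    refine (h1.hasFDerivAt.congr_of_eventuallyEq ?_).fderiv
    filter_upwards [isOpen_ball.mem_nhds hz] with x hx using hG x hx
  have h3 : wirtingerDz G z = deriv h z := by
    simp only [wirtingerDz, h2, mulAddConj_apply, map_mul, Complex.conj_I, map_one]
    linear_combination (-(deriv h z - starRingEnd ℂ (deriv g z)) / 2) * Complex.I_sq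
  have h4 : wirtingerDzbar G z = starRingEnd ℂ (deriv g z) := by
    simp only [wirtingerDzbar, h2, mulAddConj_apply, map_mul, Complex.conj_I, map_one]
    linear_combination ((deriv h z - starRingEnd ℂ (deriv g z)) / 2) * Complex.I_sq
  rw [jacobianC, h3, h4, RCLike.norm_conj]

/-- The radial factor is invariant under rotations, so `D` does not differentiate it. -/
lemma opD_norm_pow_mul {f G h g : ℂ → ℂ} (hh : DifferentiableOn ℂ h (ball 0 1))
    (hg : DifferentiableOn ℂ g (ball 0 1))
    (hG : ∀ z ∈ ball (0 : ℂ) 1, G z = h z + starRingEnd ℂ (g z)) {m : ℕ}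
    (hf : ∀ z ∈ ball (0 : ℂ) 1, f z = ((‖z‖ ^ (2 * m) : ℝ) : ℂ) * G z)
    {z : ℂ} (hz : z ∈ ball (0 : ℂ) 1) :
    opD f z = ‖z‖ ^ (2 * m) • harmonicD h g z := by
  have h1 := hasStrictFDerivAt_add_conj (hasStrictDerivAt_of_differentiableOn hh hz)
    (hasStrictDerivAt_of_differentiableOn hg hz)
  obtain ⟨c, -, h2⟩ := hasStrictFDerivAt_norm_pow_smul h1 m
  have h3 := (h2.hasFDerivAt.congr_of_eventuallyEq (f₁ := f) (by
    filter_upwards [isOpen_ball.mem_nhds hz] with x hx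
    rw [hf x hx, hG x hx, Complex.real_smul])).fderiv
  have h4 : inner ℝ z (Complex.I * z) = 0 := by
    rw [Complex.inner]
    simp
    ring
  rw [opD_eq, h3]
  simp only [add_apply, smul_apply, ContinuousLinearMap.smulRight_apply, innerSL_apply_apply, h4,
    smul_zero, zero_smul, add_zero, mulAddConj_apply, harmonicD, Complex.real_smul, map_mul,
    Complex.conj_I]
  linear_combination (-((‖z‖ ^ (2 * m) : ℝ) : ℂ) * (deriv h z * z -
    starRingEnd ℂ (deriv g z) * starRingEnd ℂ z)) * Complex.I_sq

/-! ### Univalence and covering -/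

/-- A holomorphic function whose Taylor coefficients of order at least `2` vanish is affine. -/
lemma eq_affine_of_taylorCoeff_eq_zero {h : ℂ → ℂ} (hh : DifferentiableOn ℂ h (ball 0 1))
    (h0 : ∀ n, 2 ≤ n → taylorCoeff h n = 0) {z : ℂ} (hz : z ∈ ball (0 : ℂ) 1) :
    h z = h 0 + deriv h 0 * z := by
  have hs := Complex.hasSum_taylorSeries_on_ball hh hz
  have hs2 := hasSum_sum_of_ne_finset_zero
    (L := SummationFilter.unconditional ℕ) (s := Finset.range 2)
    (f := fun n : ℕ => (n.factorial : ℂ)⁻¹ • (z - 0) ^ n • iteratedDeriv n h 0) fun n hn => by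
      have h1 := h0 n (by rw [Finset.mem_range] at hn; omega)
      have h2 : (n.factorial : ℂ) ≠ 0 := by exact_mod_cast n.factorial_ne_zero
      rw [taylorCoeff, div_eq_zero_iff] at h1
      simp [h1.resolve_right h2]
  rw [hs.unique hs2]
  simp [Finset.sum_range_succ, mul_comm]

lemma injOn_norm_pow_mul_id {α : ℂ} (hα : ‖α‖ = 1) (q : ℕ) {f : ℂ → ℂ} {s : Set ℂ}
    (hf : ∀ z ∈ s, f z = α * ((‖z‖ ^ q : ℝ) : ℂ) * z) : InjOn f s := by
  have hnorm : ∀ z ∈ s, ‖f z‖ = ‖z‖ ^ (q + 1) := fun z hz => by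
    rw [hf z hz, norm_mul, norm_mul, hα, Complex.norm_real, norm_pow, norm_norm, one_mul, pow_succ]
  intro x hx y hy hxy
  have h1 : ‖x‖ = ‖y‖ := by
    refine (pow_left_inj₀ (norm_nonneg x) (norm_nonneg y) (Nat.succ_ne_zero q)).mp ?_
    rw [← hnorm x hx, hxy, hnorm y hy]
  have hα0 : α ≠ 0 := norm_ne_zero_iff.mp (by rw [hα]; exact one_ne_zero)
  by_cases hy0 : ‖y‖ = 0
  · rw [norm_eq_zero.mp hy0, norm_eq_zero.mp (h1.trans hy0)]
  · rw [hf x hx, hf y hy, h1] at hxy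
    refine mul_left_cancel₀ (mul_ne_zero hα0 ?_) hxy
    exact_mod_cast pow_ne_zero q hy0

theorem mainTheorem2 (M : ℝ) (hM : 1 ≤ M) :
    ∃ ρ : ℝ, 0 < ρ ∧ ρ < 1 ∧ landauEq M ρ = 0 ∧
      (∀ ρ' : ℝ, 0 < ρ' → ρ' < 1 → landauEq M ρ' = 0 → ρ' = ρ) ∧
      ∀ (p : ℕ), 1 ≤ p → ∀ (f G : ℂ → ℂ),
        InnerProductSpace.HarmonicOnNhd G (ball (0 : ℂ) 1) →
        G 0 = 0 →
        jacobianC G 0 = 1 →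
        (∀ z ∈ ball (0 : ℂ) 1, ‖G z‖ ≤ M) →
        (∀ z ∈ ball (0 : ℂ) 1, f z = ((‖z‖ ^ (2 * (p - 1)) : ℝ) : ℂ) * G z) →
        InjOn (opD f) (ball (0 : ℂ) ρ) ∧
        0 < landauR M p ρ ∧
        ball (0 : ℂ) (landauR M p ρ) ⊆ opD f '' ball (0 : ℂ) ρ ∧
        (M = 1 →
          ∃ α : ℂ, ‖α‖ = 1 ∧
            (∀ z ∈ ball (0 : ℂ) 1, G z = α * z) ∧
            (∀ z ∈ ball (0 : ℂ) 1, f z = α * ((‖z‖ ^ (2 * (p - 1)) : ℝ) : ℂ) * z) ∧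
            InjOn f (ball (0 : ℂ) 1)) := by
  have hM0 : 0 ≤ M := zero_le_one.trans hM
  obtain ⟨ρ, hρ0, hρ1, hρ⟩ := exists_landauEq_eq_zero hM
  refine ⟨ρ, hρ0, by linarith, hρ, fun ρ' h0 h1 h => ?_, ?_⟩
  · exact (strictAntiOn_landauEq hM).injOn ⟨h0.le, h1⟩ ⟨hρ0.le, by linarith⟩ (h.trans hρ.symm)
  intro p hp f G hG hG0 hJ hGM hf
  obtain ⟨h, g, hh, hg, hGe⟩ := exists_eq_add_conj hG
  have h0mem : (0 : ℂ) ∈ ball (0 : ℂ) 1 := mem_ball_self one_pos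
  have hbd : ∀ z ∈ ball (0 : ℂ) 1, ‖h z + starRingEnd ℂ (g z)‖ ≤ M := fun z hz => by
    rw [← hGe z hz]
    exact hGM z hz
  have hbd' : ∀ z ∈ ball (0 : ℂ) 1, ‖g z + starRingEnd ℂ (h z)‖ ≤ M := fun z hz => by
    have := hbd z hz
    rwa [← RCLike.norm_conj, map_add, Complex.conj_conj, add_comm] at this
  have hJ' : ‖deriv h 0‖ ^ 2 - ‖deriv g 0‖ ^ 2 = 1 := by
    rw [← jacobianC_add_conj h0mem hh hg hGe, hJ]
  have hPh : ∀ n, 2 ≤ n →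
      ‖deriv h 0‖ ^ 2 + ‖deriv g 0‖ ^ 2 + ‖taylorCoeff h n‖ ^ 2 ≤ M ^ 2 := fun n hn => by
    simpa only [taylorCoeff_one] using sq_taylorCoeff_le hh hg hbd hn
  have hPg : ∀ n, 2 ≤ n →
      ‖deriv g 0‖ ^ 2 + ‖deriv h 0‖ ^ 2 + ‖taylorCoeff g n‖ ^ 2 ≤ M ^ 2 := fun n hn => by
    simpa only [taylorCoeff_one] using sq_taylorCoeff_le hg hh hbd' hn
  have hch : ∀ n, 2 ≤ n → ‖taylorCoeff h n‖ ≤ M := fun n hn =>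
    le_of_sq_le_sq (by nlinarith [hPh n hn]) hM0
  have hcg : ∀ n, 2 ≤ n → ‖taylorCoeff g n‖ ≤ M := fun n hn =>
    le_of_sq_le_sq (by nlinarith [hPg n hn]) hM0
  set a := deriv h 0 with ha
  set b := deriv g 0 with hb
  have hsum : ‖a‖ + ‖b‖ ≤ 4 * M / Real.pi := by
    simpa only [taylorCoeff_one] using taylorCoeff_one_add_le hh hg hbd
  have hlam : landauLambda0 M ≤ ‖a‖ - ‖b‖ :=
    landauLambda0_le_sub (norm_nonneg a) (norm_nonneg b) hM hJ'
      (by nlinarith [hPh 2 le_rfl, sq_nonneg ‖taylorCoeff h 2‖]) hsum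
  -- the equation for `ρ` makes `λ₀(M)` at least three times the arctangent term
  set K := 16 * M / Real.pi ^ 2 * landauS0 * Real.arctan ρ with hK
  have hK1 : 6.4 * M * ρ ≤ K := mul_le_landau_arctan hM0 hρ0.le hρ1
  have hMρ : 0 < M * ρ := by positivity
  have h3K : 3 * K ≤ landauLambda0 M := by
    have h1 : 0 ≤ 2 * landauT M * ρ / (1 - ρ) ^ 3 := by
      have := landauT_nonneg hM0
      have : 0 < 1 - ρ := by linarith
      positivity
    have h2 : landauEq M ρ = landauLambda0 M - 3 * K - 2 * landauT M * ρ / (1 - ρ) ^ 3 := by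
      rw [landauEq, hK]
      ring
    linarith
  set L : ℂ →L[ℝ] ℂ := mulAddConj a (-b) with hL
  set Φ := harmonicD h g with hΦ
  have hΦL : ∀ z, Φ z - L z = z * (deriv h z - a) - starRingEnd ℂ (z * (deriv g z - b)) := by
    intro z
    simp only [hΦ, hL, harmonicD, mulAddConj_apply, map_mul, map_neg, map_sub]
    ring
  have hLlow : ∀ v, (‖a‖ - ‖b‖) * ‖v‖ ≤ ‖L v‖ := fun v => by
    simpa only [norm_neg] using le_norm_mulAddConj a (-b) v
  -- `Φ` is a small Lipschitz perturbation of `L`, which expands by at least `‖a‖ - ‖b‖`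
  have hE : ∀ x ∈ ball (0 : ℂ) ρ, ∀ y ∈ ball (0 : ℂ) ρ,
      ‖(Φ x - L x) - (Φ y - L y)‖ ≤ 11 * M * ρ * ‖x - y‖ := by
    intro x hx y hy
    have h1 := norm_mul_deriv_sub_le hh hM0 hch hρ1 hx hy
    have h2 := norm_mul_deriv_sub_le hg hM0 hcg hρ1 hx hy
    rw [← RCLike.norm_conj, map_sub] at h2
    rw [hΦL, hΦL, sub_sub_sub_comm]
    refine (norm_sub_le _ _).trans ?_
    linarith
  have hε : 0 ≤ 11 * M * ρ := by positivity
  have hsqrt : √2 ≤ 1.42 := Real.sqrt_le_iff.mpr ⟨by norm_num, by norm_num⟩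
  -- `1.42 * 11 < 3 * 6.4`
  have hεlam : √2 * (11 * M * ρ) < ‖a‖ - ‖b‖ := by nlinarith
  have hΦ0 : Φ 0 = 0 := by simp [hΦ, harmonicD]
  have hsub : closedBall (0 : ℂ) ρ ⊆ ball 0 1 := closedBall_subset_ball (by linarith)
  have hd : ∀ z ∈ ball (0 : ℂ) 1, ∃ Φ' : ℂ →L[ℝ] ℂ, HasStrictFDerivAt Φ Φ' z :=
    fun z hz => exists_hasStrictFDerivAt_harmonicD hh hg hz
  have hcont : ContinuousOn Φ (closedBall 0 ρ) := fun z hz => by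
    obtain ⟨Φ', h1⟩ := hd z (hsub hz)
    exact h1.hasFDerivAt.continuousAt.continuousWithinAt
  have hκ : ∀ z, ‖z‖ = ρ → ρ * (landauLambda0 M - K) ≤ ‖Φ z‖ := by
    intro z hz
    have h1 := norm_deriv_sub_le hh hM0 hch (hz.le.trans hρ1)
    have h2 := norm_deriv_sub_le hg hM0 hcg (hz.le.trans hρ1)
    have h3 : ‖Φ z - L z‖ ≤ ρ * (11 / 2 * M * ρ) := by
      rw [hΦL]
      refine (norm_sub_le _ _).trans ?_
      rw [RCLike.norm_conj, norm_mul, norm_mul, hz, ← mul_add]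
      rw [hz] at h1 h2
      exact mul_le_mul_of_nonneg_left (by linarith) hρ0.le
    have h4 := hLlow z
    rw [hz] at h4
    have h5 : ‖L z‖ - ‖Φ z‖ ≤ ‖Φ z - L z‖ := by
      rw [norm_sub_rev]
      exact norm_sub_norm_le _ _
    nlinarith
  have hDf : ∀ z ∈ ball (0 : ℂ) ρ, opD f z = ‖z‖ ^ (2 * (p - 1)) • Φ z := fun z hz =>
    opD_norm_pow_mul hh hg hGe hf (hsub (ball_subset_closedBall hz))
  have hR : landauR M p ρ = ρ ^ (2 * (p - 1)) * (ρ * (landauLambda0 M - K)) := by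
    rw [landauR, ← mul_assoc, ← pow_succ, show 2 * p - 1 = 2 * (p - 1) + 1 by omega]
  refine ⟨?_, ?_, ?_, ?_⟩
  · exact (injOn_norm_pow_smul hε hεlam hLlow hΦ0 hE (2 * (p - 1))).congr fun z hz => (hDf z hz).symm
  · rw [hR]
    have : 0 < landauLambda0 M - K := by nlinarith
    positivity
  · rw [hR, image_congr hDf]
    exact ball_subset_image_norm_pow_smul hρ0 hε hεlam hLlow hΦ0 hE
      (fun z hz => hd z (hsub (ball_subset_closedBall hz))) hcont hκ (p - 1)
  · rintro rfl
    -- for `M = 1` the coefficient `a` exhausts the Parseval bound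
    have hP2 := hPh 2 le_rfl
    have ha1 : ‖a‖ = 1 := by
      have h1 : ‖a‖ ^ 2 = 1 := by nlinarith [sq_nonneg ‖b‖, sq_nonneg ‖taylorCoeff h 2‖]
      exact (pow_eq_one_iff_of_nonneg (norm_nonneg a) two_ne_zero).mp h1
    have hb0 : b = 0 := by
      rw [ha1] at hJ'
      exact norm_eq_zero.mp (pow_eq_zero_iff two_ne_zero |>.mp (by linarith))
    have hh0 : ∀ n, 2 ≤ n → taylorCoeff h n = 0 := fun n hn => by
      have h1 := hPh n hn
      rw [ha1] at h1
      exact norm_eq_zero.mp (pow_eq_zero_iff two_ne_zero |>.mp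
        (le_antisymm (by nlinarith [sq_nonneg ‖b‖]) (sq_nonneg _)))
    have hg0 : ∀ n, 2 ≤ n → taylorCoeff g n = 0 := fun n hn => by
      have h1 := hPg n hn
      rw [ha1] at h1
      exact norm_eq_zero.mp (pow_eq_zero_iff two_ne_zero |>.mp
        (le_antisymm (by nlinarith [sq_nonneg ‖b‖]) (sq_nonneg _)))
    have hGa : ∀ z ∈ ball (0 : ℂ) 1, G z = a * z := fun z hz => by
      have h1 := hGe 0 h0mem
      rw [hG0] at h1
      rw [hGe z hz, eq_affine_of_taylorCoeff_eq_zero hh hh0 hz,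
        eq_affine_of_taylorCoeff_eq_zero hg hg0 hz, ← ha, ← hb, hb0, zero_mul, add_zero]
      linear_combination -h1
    have hfa : ∀ z ∈ ball (0 : ℂ) 1, f z = a * ((‖z‖ ^ (2 * (p - 1)) : ℝ) : ℂ) * z :=
      fun z hz => by
        rw [hf z hz, hGa z hz]
        ring
    exact ⟨a, ha1, hGa, hfa, injOn_norm_pow_mul_id ha1 _ hfa⟩
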